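/- A matroid $N$ is a (single-element) extension of a matroid $M$ if $N\backslash e = M$ for some element $e$ of $N$ that is not a coloop of $N$; extensions are counted with $M$ labelled and with a fixed name $e$, not in the ground set of $M$, for the new element. Let $M(K_{n+1})$ denote the cycle matroid of the complete graph on $n+1$ vertices. Then the number of extensions of $M(K_{n+1})$ is $$2^{\binom{n}{\lfloor n/2\rfloor}(1+o(1))},$$ where $o(1)$ denotes a function of $n$ that tends to $0$ as $n\to\infty$. -/

import Mathlib

namespace CliqueExt

open SimpleGraph

/-- If both `I` and `J` are edge sets of forests and `J` has more edges, then some edge of `J`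
can be added to `I` so that it stays a forest. -/
theorem forest_augment {V : Type*} [Finite V] {I J : Set (Sym2 V)}
    (hId : ∀ e ∈ I, ¬ e.IsDiag) (hJd : ∀ e ∈ J, ¬ e.IsDiag)
    (hI : (fromEdgeSet I).IsAcyclic) (hJ : (fromEdgeSet J).IsAcyclic)
    (hlt : I.ncard < J.ncard) :
    ∃ e ∈ J, e ∉ I ∧ (fromEdgeSet (insert e I)).IsAcyclic := by
  classical
  by_contra! hcon
  have hes : ∀ {S : Set (Sym2 V)}, (∀ e ∈ S, ¬ e.IsDiag) → (fromEdgeSet S).edgeSet = S := by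
    intro S hS
    rw [edgeSet_fromEdgeSet]
    ext e
    constructor
    · exact fun h => h.1
    · exact fun h => ⟨h, fun h' => hS e h h'⟩
  have hne : Nonempty V := by
    by_contra hV
    rw [not_nonempty_iff] at hV
    rw [Set.eq_empty_of_isEmpty J] at hlt
    simp at hlt
  have key : ∀ u v, s(u, v) ∈ J → (fromEdgeSet I).Reachable u v := by
    intro u v huv
    by_cases hmem : s(u, v) ∈ I
    · refine Adj.reachable ?_
      rw [fromEdgeSet_adj]
      exact ⟨hmem, fun h => hId _ hmem (by simpa using h)⟩
    · by_contra hr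
      refine hcon _ huv hmem ?_
      have h := IsAcyclic.sup_edge_of_not_reachable hr hI
      have heq : fromEdgeSet (insert s(u, v) I) = fromEdgeSet I ⊔ edge u v := by
        rw [edge, ← fromEdgeSet_union, Set.union_comm, Set.singleton_union]
      rwa [heq]
  obtain ⟨T, hJT, -, hT⟩ : ∃ T : SimpleGraph V, fromEdgeSet J ≤ T ∧ T ≤ ⊤ ∧ T.IsTree := by
    obtain ⟨T, h1, h2, h3⟩ :=
      (connected_top (V := V)).exists_isTree_le_of_le_of_isAcyclic le_top hJ
    exact ⟨T, h1, h2, h3⟩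
  have hJsub : J ⊆ T.edgeSet := by
    rw [← hes hJd]
    exact edgeSet_mono hJT
  have hXd : ∀ e ∈ I ∪ (T.edgeSet \ J), ¬ e.IsDiag := by
    rintro e (he | he)
    · exact hId e he
    · exact T.not_isDiag_of_mem_edgeSet he.1
  have hadj : ∀ u v, T.Adj u v → (fromEdgeSet (I ∪ (T.edgeSet \ J))).Reachable u v := by
    intro u v huv
    by_cases hmem : s(u, v) ∈ J
    · exact (key u v hmem).mono (fromEdgeSet_mono Set.subset_union_left)
    · refine Adj.reachable ?_
      rw [fromEdgeSet_adj]
      exact ⟨Or.inr ⟨huv, hmem⟩, huv.ne⟩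
  have hconn : (fromEdgeSet (I ∪ (T.edgeSet \ J))).Connected := by
    refine ⟨fun u v => ?_⟩
    obtain ⟨p⟩ := hT.connected.preconnected u v
    induction p with
    | nil => exact Reachable.refl _
    | cons h _ ih => exact (hadj _ _ h).trans ih
  have h1 := hconn.card_vert_le_card_edgeSet_add_one
  have h2 := (isTree_iff_connected_and_card.1 hT).2
  rw [hes hXd] at h1
  rw [Nat.card_coe_set_eq] at h1 h2
  have h3 := Set.ncard_union_le I (T.edgeSet \ J)
  have h4 := Set.ncard_sdiff_add_ncard_of_subset hJsub
  omega

/-- The cycle matroid `M(G)` of a finite simple graph `G`: its ground set is the edge set of `G`,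
and a set of edges is independent if and only if it contains no cycle. -/
def cycleMatroid {V : Type*} [Finite V] (G : SimpleGraph V) : Matroid (Sym2 V) :=
  (IndepMatroid.ofFinite (E := G.edgeSet) (Set.toFinite _)
    (fun I => I ⊆ G.edgeSet ∧ (fromEdgeSet I).IsAcyclic)
    (by simp)
    (fun _ _ hJ hIJ => ⟨hIJ.trans hJ.1, hJ.2.anti (fromEdgeSet_mono hIJ)⟩)
    (fun I J hI hJ hlt => by
      obtain ⟨e, heJ, heI, he⟩ := forest_augment
        (fun e he => G.not_isDiag_of_mem_edgeSet (hI.1 he))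
        (fun e he => G.not_isDiag_of_mem_edgeSet (hJ.1 he)) hI.2 hJ.2 hlt
      exact ⟨e, heJ, heI, Set.insert_subset (hJ.1 heJ) hI.1, he⟩)
    (fun _ hI => hI.1)).matroid

/-- The (single-element) extensions of a matroid `M` on `α`. The elements of `M` are regarded as
elements of `Option α` through `some`, and `none` is the name of the new element `e`. An extension
is a matroid `N` with an element `e` that is not a coloop of `N` such that `N ＼ {e} = M`. -/
def extensions {α : Type*} (M : Matroid α) : Set (Matroid (Option α)) :=
  {N | none ∈ N.E ∧ ¬ N.IsColoop none ∧
    N.delete {none} = M.map some (Option.some_injective α).injOn}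

end CliqueExt

/-! ### Counting antichains of subsets of a finite set. -/

section Antichains

open Finset Numbering

/-! An extension is determined by the hyperplanes of `M(K_{n+1})` that span the new element. These
hyperplanes are the cuts {A, Aᶜ}; naming a cut by its side avoiding vertex 0 turns the chosen
hyperplanes into a family of nonempty subsets of an n-set. A flat of corank 2 is a partition of the
vertices into three parts, and lies in exactly three hyperplanes. If two of these are chosen, so is
the third (`union_mem_cutClass`), so the family is closed under disjoint unions and proper
differences.

Upper bound: by `subset_of_minimal_mem` such a family is determined by its minimal members, which
form an antichain. Antichains are counted by a container argument (`card_independent_subsets_le`) on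
the comparability graph. Its supersaturation input, `card_mul_le_of_few_comparable`, is a version of
the LYM inequality allowing a few comparable pairs. With N the middle binomial coefficient, this
gives 2^(N(1+o(1))).

Lower bound: if 2k > n, k-subsets are pairwise intersecting and non-nested, so the closure condition
is vacuous and every set of k-subsets yields its own extension
(`two_pow_choose_le_ncard_extensions`). Take k = ⌊n/2⌋ + 1. -/

/-- A recursive form of the graph container method: a bound on the number of independent subsets
of `A` for an irreflexive relation `r`, given that all sets in which every element has fewer than
`d` neighbours have at most `m` elements. -/
theorem card_independent_subsets_le {α : Type*} [DecidableEq α] (r : α → α → Prop)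
    [DecidableRel r] (hr : ∀ a, ¬ r a a) {d m : ℕ} {β : ℝ} (hβ : 0 ≤ β)
    (hβd : 1 ≤ β * (1 + β) ^ d)
    (hm : ∀ A : Finset α, (∀ a ∈ A, #{b ∈ A | r a b} < d) → #A ≤ m) (A : Finset α) :
    (#{I ∈ A.powerset | ∀ a ∈ I, ∀ b ∈ I, ¬ r a b} : ℝ) ≤ 2 ^ m * (1 + β) ^ #A := by
  induction A using Finset.strongInduction with
  | H A ih =>
  have h1β : (1 : ℝ) ≤ 1 + β := by linarith
  by_cases hA : ∀ a ∈ A, #{b ∈ A | r a b} < d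
  · calc (#{I ∈ A.powerset | ∀ a ∈ I, ∀ b ∈ I, ¬ r a b} : ℝ) ≤ (#A.powerset : ℝ) := by
          exact_mod_cast card_filter_le _ _
      _ = 2 ^ #A := by simp
      _ ≤ 2 ^ m := pow_le_pow_right₀ (by norm_num) (hm A hA)
      _ ≤ 2 ^ m * (1 + β) ^ #A := le_mul_of_one_le_right (by positivity) (one_le_pow₀ h1β)
  · push Not at hA
    obtain ⟨v, hv, hd⟩ := hA
    set A₁ := A.erase v with hA₁
    set A₂ := A₁ \ {b ∈ A | r v b} with hA₂
    have hsub : {I ∈ A.powerset | ∀ a ∈ I, ∀ b ∈ I, ¬ r a b} ⊆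
        {I ∈ A₁.powerset | ∀ a ∈ I, ∀ b ∈ I, ¬ r a b} ∪
          ({I ∈ A₂.powerset | ∀ a ∈ I, ∀ b ∈ I, ¬ r a b}).image (insert v) := by
      intro I hI
      rw [mem_filter, mem_powerset] at hI
      obtain ⟨hIA, hI⟩ := hI
      rw [mem_union, mem_filter, mem_powerset, mem_image]
      by_cases hvI : v ∈ I
      · right
        refine ⟨I.erase v, ?_, insert_erase hvI⟩
        rw [mem_filter, mem_powerset]
        refine ⟨fun x hx => ?_, fun a ha b hb => hI a (mem_of_mem_erase ha) b (mem_of_mem_erase hb)⟩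
        have hxI := mem_of_mem_erase hx
        rw [hA₂, mem_sdiff, hA₁, mem_erase, mem_filter]
        exact ⟨⟨ne_of_mem_erase hx, hIA hxI⟩, fun h => hI v hvI x hxI h.2⟩
      · left
        exact ⟨subset_erase.2 ⟨hIA, hvI⟩, hI⟩
    have hc₁ : #A₁ + 1 = #A := card_erase_add_one hv
    have hc₂ : #A₂ + d ≤ #A₁ := by
      have hN : {b ∈ A | r v b} ⊆ A₁ := by
        intro b hb
        rw [mem_filter] at hb
        exact mem_erase.2 ⟨fun h => hr v (h ▸ hb.2), hb.1⟩
      have h := card_sdiff_add_card_eq_card hN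
      rw [← hA₂] at h
      omega
    have hss₁ : A₁ ⊂ A := erase_ssubset hv
    have hss₂ : A₂ ⊂ A := lt_of_le_of_lt sdiff_subset hss₁
    have hcard : (#{I ∈ A.powerset | ∀ a ∈ I, ∀ b ∈ I, ¬ r a b} : ℝ) ≤
        (#{I ∈ A₁.powerset | ∀ a ∈ I, ∀ b ∈ I, ¬ r a b} : ℝ) +
          (#{I ∈ A₂.powerset | ∀ a ∈ I, ∀ b ∈ I, ¬ r a b} : ℝ) := by
      exact_mod_cast (card_le_card hsub).trans
        ((card_union_le _ _).trans (Nat.add_le_add_left card_image_le _))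
    -- Choosing `v` excludes its at least `d` neighbours, which makes this branch cost at most `β`
    -- times the other; the two together give the factor `1 + β` for `v`.
    have hpow : (1 + β) ^ #A₂ ≤ β * (1 + β) ^ #A₁ := by
      calc (1 + β) ^ #A₂ ≤ (1 + β) ^ #A₂ * (β * (1 + β) ^ d) :=
            le_mul_of_one_le_right (by positivity) hβd
        _ = β * (1 + β) ^ (#A₂ + d) := by ring
        _ ≤ β * (1 + β) ^ #A₁ :=
            mul_le_mul_of_nonneg_left (pow_le_pow_right₀ h1β hc₂) hβ
    calc _ ≤ _ := hcard
      _ ≤ 2 ^ m * (1 + β) ^ #A₁ + 2 ^ m * (1 + β) ^ #A₂ := add_le_add (ih _ hss₁) (ih _ hss₂)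
      _ ≤ 2 ^ m * (1 + β) ^ #A₁ + 2 ^ m * (β * (1 + β) ^ #A₁) := by gcongr
      _ = 2 ^ m * (1 + β) ^ #A := by rw [← hc₁]; ring

variable {X : Type*} [Fintype X] [DecidableEq X]

/-- Swapping an element of `s` with an element outside of `s`, without affecting `t`, moves a
numbering with prefixes `s` and `t` to one with prefix `t`, and this can be reversed. -/
theorem card_mul_card_prefixed_inter_le {s t U W : Finset X} (hU : U ⊆ s) (hW : Disjoint W s)
    (ht : ∀ x ∈ U, ∀ y ∈ W, (x ∈ t ↔ y ∈ t)) :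
    #U * #W * #(prefixed s ∩ prefixed t) ≤ #(prefixed t) := by
  rw [← card_product, ← card_product]
  refine card_le_card_of_injOn (fun p => (Equiv.swap p.1.1 p.1.2).trans p.2) ?_ ?_
  · rintro ⟨⟨x, y⟩, f⟩ h
    simp only [coe_product, Set.mem_prod, mem_coe, mem_inter, mem_prefixed] at h
    obtain ⟨⟨hx, hy⟩, -, hft⟩ := h
    rw [mem_coe, mem_prefixed]
    intro z
    have hxy := ht x hx y hy
    rw [Equiv.trans_apply, ← hft]
    rcases eq_or_ne z x with rfl | hzx
    · rw [Equiv.swap_apply_left]; exact hxy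
    rcases eq_or_ne z y with rfl | hzy
    · rw [Equiv.swap_apply_right]; exact hxy.symm
    rw [Equiv.swap_apply_of_ne_of_ne hzx hzy]
  · rintro ⟨⟨x, y⟩, f⟩ h ⟨⟨x', y'⟩, f'⟩ h' heq
    simp only [coe_product, Set.mem_prod, mem_coe, mem_inter, mem_prefixed] at h h'
    obtain ⟨⟨hx, hy⟩, hf, -⟩ := h
    obtain ⟨⟨hx', hy'⟩, hf', -⟩ := h'
    -- Both numberings put `s` in the same initial positions, so the swapped numbering determines
    -- the image of `s` under the swap. Then `x` is the only element to leave `s` and `y` the only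
    -- one to enter.
    have hmem : ∀ z, Equiv.swap x y z ∈ s ↔ Equiv.swap x' y' z ∈ s := by
      intro z
      rw [hf, hf']
      have := congrArg (fun g : X ≃ Fin (Fintype.card X) => g z) heq
      simp only [Equiv.trans_apply] at this
      rw [this]
    have hys := disjoint_left.1 hW hy
    have hys' := disjoint_left.1 hW hy'
    have hxx : x = x' := by
      by_contra hne
      have h1 := hmem x
      rw [Equiv.swap_apply_left,
        Equiv.swap_apply_of_ne_of_ne hne (fun h => hys' (by rw [← h]; exact hU hx))] at h1
      exact hys (h1.2 (hU hx))
    have hyy : y = y' := by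
      by_contra hne
      have h1 := hmem y
      rw [Equiv.swap_apply_right,
        Equiv.swap_apply_of_ne_of_ne (fun h => hys (by rw [h]; exact hU hx')) hne] at h1
      exact hys (h1.1 (hU hx))
    subst hxx hyy
    simp only [Prod.mk.injEq, true_and]
    ext z
    have := congrArg (fun g : X ≃ Fin (Fintype.card X) => g (Equiv.swap x y z)) heq
    simpa using congrArg Fin.val this

/-- If `a ⊂ b` are nonempty proper subsets of `X`, then few numberings have both as prefixes. -/
theorem card_prefixed_inter_le {a b : Finset X} (hab : a ⊂ b) (ha : a.Nonempty)
    (hb : b ≠ univ) :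
    ((Fintype.card X : ℝ) / 2 - 1) * #(prefixed a ∩ prefixed b) ≤ #(prefixed a) + #(prefixed b) := by
  have hba : (b \ a).Nonempty := sdiff_nonempty.2 hab.2
  have hbc : bᶜ.Nonempty := by
    rwa [nonempty_iff_ne_empty, Ne, compl_eq_empty_iff]
  have h1 : #a * #(b \ a) * #(prefixed a ∩ prefixed b) ≤ #(prefixed b) :=
    card_mul_card_prefixed_inter_le subset_rfl disjoint_sdiff_self_left fun x hx y hy =>
      iff_of_true (hab.1 hx) (mem_sdiff.1 hy).1
  have h2 : #(b \ a) * #bᶜ * #(prefixed a ∩ prefixed b) ≤ #(prefixed a) := by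
    rw [inter_comm]
    exact card_mul_card_prefixed_inter_le sdiff_subset disjoint_compl_left fun x hx y hy =>
      iff_of_false (mem_sdiff.1 hx).2 fun h => mem_compl.1 hy (hab.1 h)
  have hsum : #a + #(b \ a) + #bᶜ = Fintype.card X := by
    rw [add_comm #a, card_sdiff_add_card_eq_card hab.1, card_add_card_compl]
  have ha1 : (1 : ℝ) ≤ #a := by exact_mod_cast ha.card_pos
  have hba1 : (1 : ℝ) ≤ #(b \ a) := by exact_mod_cast hba.card_pos
  have hbc1 : (1 : ℝ) ≤ #bᶜ := by exact_mod_cast hbc.card_pos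
  have hsum' : (#a : ℝ) + #(b \ a) + #bᶜ = Fintype.card X := by exact_mod_cast hsum
  have h1' : (#a * #(b \ a) * #(prefixed a ∩ prefixed b) : ℝ) ≤ #(prefixed b) := by exact_mod_cast h1
  have h2' : (#(b \ a) * #bᶜ * #(prefixed a ∩ prefixed b) : ℝ) ≤ #(prefixed a) := by exact_mod_cast h2
  -- With q = `#(b \ a)` and n = `Fintype.card X` the right side is q(n - q) with 1 ≤ q ≤ n - 2,
  -- hence at least n - 1; the weaker bound suffices.
  have hle : (Fintype.card X : ℝ) / 2 - 1 ≤ #a * #(b \ a) + #(b \ a) * #bᶜ := by nlinarith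
  calc _ ≤ (#a * #(b \ a) + #(b \ a) * #bᶜ : ℝ) * #(prefixed a ∩ prefixed b) :=
        mul_le_mul_of_nonneg_right hle (Nat.cast_nonneg _)
    _ ≤ _ := by linarith

/-- A family of nonempty proper subsets of `X`, each of which is comparable to fewer than `d`
others, is not much larger than the middle layer. -/
theorem card_mul_le_of_few_comparable {A : Finset (Finset X)} {d : ℕ}
    (hne : ∀ a ∈ A, a.Nonempty) (huniv : univ ∉ A)
    (hd : ∀ a ∈ A, #{b ∈ A | a ⊂ b ∨ b ⊂ a} ≤ d)
    (hdX : (d : ℝ) < (Fintype.card X : ℝ) / 2 - 1) :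
    (#A : ℝ) * (1 - d / ((Fintype.card X : ℝ) / 2 - 1)) ≤
      (Fintype.card X).choose (Fintype.card X / 2) := by
  set n := Fintype.card X with hn
  set h : ℝ := (n : ℝ) / 2 - 1 with hh
  have hh0 : 0 < h := lt_of_le_of_lt (Nat.cast_nonneg d) hdX
  set S : ℝ := ∑ a ∈ A, (#(prefixed a) : ℝ) with hS
  have hfact : (0 : ℝ) < (n.factorial : ℝ) := by exact_mod_cast n.factorial_pos
  have hlow : (#A : ℝ) * n.factorial ≤ n.choose (n / 2) * S := by
    rw [hS, mul_sum, ← nsmul_eq_mul]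
    refine card_nsmul_le_sum A _ _ fun a _ => ?_
    rw [card_prefixed, ← Nat.choose_mul_factorial_mul_factorial (card_le_univ a), mul_assoc]
    push_cast
    gcongr
    exact_mod_cast Nat.choose_le_middle _ _
  let Q : Finset (Finset X × Finset X) := {p ∈ A ×ˢ A | p.1 ⊂ p.2}
  have hswap : S = ∑ f : Numbering X, (#{a ∈ A | f ∈ prefixed a} : ℝ) := by
    have := sum_card_bipartiteAbove_eq_sum_card_bipartiteBelow (s := A)
      (t := (univ : Finset (Numbering X))) (fun a f => f ∈ prefixed a)
    simp only [bipartiteAbove, bipartiteBelow, filter_univ_mem] at this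
    rw [hS]
    exact_mod_cast this
  have hswapQ : ∑ p ∈ Q, (#(prefixed p.1 ∩ prefixed p.2) : ℝ) =
      ∑ f : Numbering X, (#{p ∈ Q | f ∈ prefixed p.1 ∩ prefixed p.2} : ℝ) := by
    have := sum_card_bipartiteAbove_eq_sum_card_bipartiteBelow (s := Q)
      (t := (univ : Finset (Numbering X))) (fun p f => f ∈ prefixed p.1 ∩ prefixed p.2)
    simp only [bipartiteAbove, bipartiteBelow, filter_univ_mem] at this
    exact_mod_cast this
  -- The prefixes of one numbering form a chain; pairing its smallest member in `A` with each of the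
  -- others gives one pair fewer than there are members.
  have hchain : ∀ f : Numbering X, #{a ∈ A | f ∈ prefixed a} ≤
      #{p ∈ Q | f ∈ prefixed p.1 ∩ prefixed p.2} + 1 := by
    intro f
    rcases ({a ∈ A | f ∈ prefixed a}).eq_empty_or_nonempty with he | hne'
    · rw [he]; simp
    obtain ⟨a, ha, hmin⟩ := exists_min_image _ card hne'
    rw [← card_erase_add_one ha]
    refine Nat.add_le_add_right (card_le_card_of_injOn (fun b => (a, b)) ?_ ?_) 1
    · intro b hb
      rw [mem_coe, mem_erase] at hb
      have hb' := mem_filter.1 hb.2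
      have ha' := mem_filter.1 ha
      have hsub := (mem_prefixed.1 ha'.2).subset_of_card_le_card (mem_prefixed.1 hb'.2)
        (hmin b hb.2)
      simp only [Q, coe_filter, mem_filter, mem_product, mem_inter, Set.mem_ofPred_eq]
      exact ⟨⟨⟨ha'.1, hb'.1⟩, hsub.ssubset_of_ne hb.1.symm⟩, ha'.2, hb'.2⟩
    · intro b _ c _ hbc
      exact (Prod.mk.inj hbc).2
  have hup : S ≤ ∑ p ∈ Q, (#(prefixed p.1 ∩ prefixed p.2) : ℝ) + n.factorial := by
    rw [hswap, hswapQ]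
    have hcard : (n.factorial : ℝ) = ∑ _f : Numbering X, (1 : ℝ) := by
      simp [hn]
    rw [hcard, ← sum_add_distrib]
    exact sum_le_sum fun f _ => by exact_mod_cast hchain f
  have hpairs : h * ∑ p ∈ Q, (#(prefixed p.1 ∩ prefixed p.2) : ℝ) ≤ d * S := by
    calc h * ∑ p ∈ Q, (#(prefixed p.1 ∩ prefixed p.2) : ℝ)
        ≤ ∑ p ∈ Q, ((#(prefixed p.1) : ℝ) + #(prefixed p.2)) := by
          rw [mul_sum]
          refine sum_le_sum fun p hp => ?_
          simp only [Q, mem_filter, mem_product] at hp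
          exact card_prefixed_inter_le hp.2 (hne _ hp.1.1) fun h => huniv (h ▸ hp.1.2)
      _ = ∑ a ∈ A, (#{b ∈ A | a ⊂ b ∨ b ⊂ a} : ℝ) * #(prefixed a) := by
          have hdisj : ∀ a : Finset X, #{b ∈ A | a ⊂ b ∨ b ⊂ a} =
              #{b ∈ A | a ⊂ b} + #{b ∈ A | b ⊂ a} := by
            intro a
            rw [filter_or, card_union_of_disjoint]
            rw [disjoint_filter]
            exact fun b _ h1 h2 => h1.2 h2.1
          simp only [hdisj, Nat.cast_add, add_mul, sum_add_distrib, Q, sum_filter, sum_product]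
          congr 1
          · refine sum_congr rfl fun a _ => ?_
            rw [← sum_filter, sum_const, nsmul_eq_mul]
          · rw [sum_comm]
            refine sum_congr rfl fun a _ => ?_
            rw [← sum_filter, sum_const, nsmul_eq_mul]
      _ ≤ ∑ a ∈ A, (d : ℝ) * #(prefixed a) := by
          refine sum_le_sum fun a ha => ?_
          gcongr
          exact hd a ha
      _ = d * S := by rw [hS, mul_sum]
  have hS1 : S * (1 - d / h) ≤ n.factorial := by
    have : ∑ p ∈ Q, (#(prefixed p.1 ∩ prefixed p.2) : ℝ) ≤ d / h * S := by
      rw [div_mul_eq_mul_div, le_div_iff₀ hh0]; linarith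
    linarith
  have h1d : 0 ≤ 1 - d / h := by
    rw [sub_nonneg, div_le_one hh0]; exact hdX.le
  have := mul_le_mul_of_nonneg_right hlow h1d
  have h3 : (n.choose (n / 2) : ℝ) * (S * (1 - d / h)) ≤ n.choose (n / 2) * n.factorial :=
    mul_le_mul_of_nonneg_left hS1 (by positivity)
  refine le_of_mul_le_mul_right ?_ hfact
  linarith

/-- An upper bound on the number of antichains of subsets of `X`. -/
theorem card_antichains_le {d m : ℕ} {β : ℝ} (hβ : 0 ≤ β) (hβd : 1 ≤ β * (1 + β) ^ d)
    (hdX : (d : ℝ) < (Fintype.card X : ℝ) / 2 - 1)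
    (hm : ((Fintype.card X).choose (Fintype.card X / 2) : ℝ) ≤
      m * (1 - d / ((Fintype.card X : ℝ) / 2 - 1))) :
    (#{I : Finset (Finset X) | ∀ a ∈ I, ∀ b ∈ I, ¬ (a ⊂ b ∨ b ⊂ a)} : ℝ) ≤
      2 ^ (m + 2) * (1 + β) ^ 2 ^ Fintype.card X := by
  -- The extra 2 in `m + 2` pays for `∅` and `univ`, which the supersaturation bound excludes.
  have hkey := card_independent_subsets_le (fun a b : Finset X => a ⊂ b ∨ b ⊂ a) (by simp)
    hβ hβd (m := m + 2) (fun A hA => ?_) univ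
  · simpa using hkey
  · have hh0 : (0 : ℝ) < (Fintype.card X : ℝ) / 2 - 1 := lt_of_le_of_lt (Nat.cast_nonneg d) hdX
    have h1d : 0 < 1 - d / ((Fintype.card X : ℝ) / 2 - 1) := by
      rw [sub_pos, div_lt_one hh0]; exact hdX
    have hle := card_mul_le_of_few_comparable (A := (A.erase ∅).erase univ) (d := d) ?_ (by simp)
      ?_ hdX
    · have h1 := le_of_mul_le_mul_right (hle.trans hm) h1d
      have h1 : #((A.erase ∅).erase univ) ≤ m := by exact_mod_cast h1
      have h2 := pred_card_le_card_erase (s := A.erase ∅) (a := univ)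
      have h3 := pred_card_le_card_erase (s := A) (a := ∅)
      omega
    · intro a ha
      exact nonempty_iff_ne_empty.2 (ne_of_mem_erase (mem_of_mem_erase ha))
    · intro a ha
      refine le_trans (card_le_card ?_) (hA a (mem_of_mem_erase (mem_of_mem_erase ha))).le
      exact filter_subset_filter _ ((erase_subset _ _).trans (erase_subset _ _))

end Antichains

/-! ### Constructing extensions from a modular-cut predicate. -/

namespace CliqueExt

open SimpleGraph Set

section ExtensionExistence

variable {α : Type*}

theorem indep_augment_ncard [Finite α] {M : Matroid α} {I J : Set α} (hI : M.Indep I)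
    (hJ : M.Indep J) (h : I.ncard < J.ncard) : ∃ e ∈ J, e ∉ I ∧ M.Indep (insert e I) := by
  obtain ⟨e, he, hi⟩ := hI.augment hJ (by
    rw [← I.toFinite.cast_ncard_eq, ← J.toFinite.cast_ncard_eq]
    exact_mod_cast h)
  exact ⟨e, he.1, he.2, hi⟩

/-- An element of `I` not spanned by `J` would enlarge `J` to an independent set bigger than `I`,
from which `I` could be augmented, although everything in that set is spanned by `I`. -/
theorem subset_closure_of_subset_closure_of_ncard_le [Finite α] {M : Matroid α} {I J : Set α}
    (hI : M.Indep I) (hJ : M.Indep J) (hJI : J ⊆ M.closure I) (h : I.ncard ≤ J.ncard) :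
    I ⊆ M.closure J := by
  intro g hg
  by_contra hgJ
  have hgJ' : g ∉ J := fun h => hgJ (M.mem_closure_of_mem h hJ.subset_ground)
  have hi : M.Indep (insert g J) :=
    (hJ.notMem_closure_iff_of_notMem hgJ' (hI.subset_ground hg)).1 hgJ
  obtain ⟨f, hf, hfI, hfi⟩ := indep_augment_ncard hI hi (by
    rw [ncard_insert_of_notMem hgJ']; omega)
  rw [hI.insert_indep_iff_of_notMem hfI] at hfi
  rcases hf with rfl | hf
  · exact hfI hg
  · exact hfi.2 (hJI hf)

theorem ncard_eq_preimage_some_of_notMem [Finite α] {J : Set (Option α)} (h : none ∉ J) :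
    J.ncard = (some ⁻¹' J).ncard := by
  rw [← ncard_image_of_injective (some ⁻¹' J) (Option.some_injective α)]
  congr 1
  ext (_ | x) <;> simp [h]

theorem eq_insert_none_of_mem {J : Set (Option α)} (h : none ∈ J) :
    J = insert none (some '' (some ⁻¹' J)) := by
  ext (_ | x) <;> simp [h]

theorem eq_image_some_of_notMem {J : Set (Option α)} (h : none ∉ J) :
    J = some '' (some ⁻¹' J) := by
  ext (_ | x) <;> simp [h]

theorem ncard_eq_preimage_some_of_mem [Finite α] {J : Set (Option α)} (h : none ∈ J) :
    J.ncard = (some ⁻¹' J).ncard + 1 := by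
  rw [← ncard_image_of_injective (some ⁻¹' J) (Option.some_injective α),
    ← ncard_insert_of_notMem (a := none) (by simp), ← eq_insert_none_of_mem h]

theorem preimage_some_insert_some (f : α) (J : Set (Option α)) :
    some ⁻¹' (insert (some f) J) = insert f (some ⁻¹' J) := by
  ext x; simp

theorem preimage_some_insert_none (J : Set (Option α)) :
    some ⁻¹' (insert none J) = some ⁻¹' J := by
  ext x; simp

/-- If `P` behaves like the predicate of spanning a flat of a modular cut, then there is an
extension of `M` whose new element is spanned by exactly the independent sets with `P`. -/
theorem exists_extension_of_modular [Finite α] (M : Matroid α) (P : Set α → Prop)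
    (hmono : ∀ ⦃I J⦄, I ⊆ J → P I → P J) (hcl : ∀ I, P (M.closure I) → P I)
    (hmod : ∀ I f g, g ∉ I → f ∉ insert g I → M.Indep (insert f (insert g I)) →
      P (insert f I) → P (insert g I) → P I)
    (hE : P M.E) :
    ∃ N ∈ extensions M, ∀ J, N.Indep J ↔
      M.Indep (some ⁻¹' J) ∧ (none ∈ J → ¬ P (some ⁻¹' J)) := by
  let Ind : Set (Option α) → Prop := fun J =>
    M.Indep (some ⁻¹' J) ∧ (none ∈ J → ¬ P (some ⁻¹' J))
  have haug : ∀ ⦃I J⦄, Ind I → Ind J → I.ncard < J.ncard →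
      ∃ e ∈ J, e ∉ I ∧ Ind (insert e I) := by
    rintro I J ⟨hI, hIP⟩ ⟨hJ, hJP⟩ hlt
    by_cases hnI : none ∈ I
    · specialize hIP hnI
      rw [ncard_eq_preimage_some_of_mem hnI] at hlt
      have hlt' : (some ⁻¹' I).ncard < (some ⁻¹' J).ncard := by
        by_cases hnJ : none ∈ J
        · rw [ncard_eq_preimage_some_of_mem hnJ] at hlt; omega
        · rw [ncard_eq_preimage_some_of_notMem hnJ] at hlt; omega
      by_contra! hcon
      have hall : ∀ f, some f ∈ J → some f ∉ I → M.Indep (insert f (some ⁻¹' I)) →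
          P (insert f (some ⁻¹' I)) := by
        intro f hfJ hfI hi
        by_contra hP
        refine hcon (some f) hfJ hfI ⟨?_, fun _ => ?_⟩ <;> rwa [preimage_some_insert_some]
      obtain ⟨f, hfJ, hfI, hfi⟩ := indep_augment_ncard hI hJ hlt'
      have hPf := hall f hfJ hfI hfi
      -- If augmentation fails, every admissible one-element addition to `I` has `P`; two
      -- independent ones would give `P` for `I` itself by modularity. So `I` plus `f` spans the old
      -- part of `J`, and comparing sizes carries `P` over to `J`.
      have hno : ∀ g, some g ∈ J → g ∉ insert f (some ⁻¹' I) →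
          ¬ M.Indep (insert g (insert f (some ⁻¹' I))) := by
        intro g hgJ hg hi
        refine hIP (hmod _ g f hfI hg hi (hall g hgJ (fun h => hg (Or.inr h)) ?_) hPf)
        exact hi.subset (insert_subset_insert (subset_insert _ _))
      have hle : (some ⁻¹' J).ncard ≤ (insert f (some ⁻¹' I)).ncard := by
        by_contra! h
        obtain ⟨g, hgJ, hg, hi⟩ := indep_augment_ncard hfi hJ h
        exact hno g hgJ hg hi
      rw [ncard_insert_of_notMem hfI] at hle
      have hnJ : none ∈ J := by
        by_contra hnJ
        rw [ncard_eq_preimage_some_of_notMem hnJ] at hlt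
        omega
      refine hJP hnJ (hcl _ (hmono (subset_closure_of_subset_closure_of_ncard_le hfi hJ ?_ ?_) hPf))
      · intro g hgJ
        by_contra hg
        have hg' : g ∉ insert f (some ⁻¹' I) :=
          fun h => hg (M.mem_closure_of_mem h hfi.subset_ground)
        exact hno g hgJ hg'
          ((hfi.notMem_closure_iff_of_notMem hg' (hJ.subset_ground hgJ)).1 hg)
      · rw [ncard_insert_of_notMem hfI]; omega
    · rw [ncard_eq_preimage_some_of_notMem hnI] at hlt
      have hadd : ∀ f, some f ∈ J → some f ∉ I → M.Indep (insert f (some ⁻¹' I)) →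
          ∃ e ∈ J, e ∉ I ∧ Ind (insert e I) := by
        intro f hfJ hfI hi
        refine ⟨some f, hfJ, hfI, ?_, fun h => ?_⟩
        · rwa [preimage_some_insert_some]
        · simp [hnI] at h
      by_cases hlt' : (some ⁻¹' I).ncard < (some ⁻¹' J).ncard
      · obtain ⟨f, hfJ, hfI, hfi⟩ := indep_augment_ncard hI hJ hlt'
        exact hadd f hfJ hfI hfi
      · have hnJ : none ∈ J := by
          by_contra hnJ
          rw [ncard_eq_preimage_some_of_notMem hnJ] at hlt
          omega
        rw [ncard_eq_preimage_some_of_mem hnJ] at hlt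
        by_cases hsub : (some ⁻¹' J) ⊆ M.closure (some ⁻¹' I)
        · refine ⟨none, hnJ, hnI, ?_, fun _ hP => hJP hnJ (hcl _
            (hmono (I := some ⁻¹' I) ?_ ?_))⟩
          · rwa [preimage_some_insert_none]
          · exact subset_closure_of_subset_closure_of_ncard_le hI hJ hsub (by omega)
          · rwa [preimage_some_insert_none] at hP
        · obtain ⟨f, hfJ, hf⟩ := not_subset.1 hsub
          have hfI : f ∉ some ⁻¹' I := fun h => hf (M.mem_closure_of_mem h hI.subset_ground)
          exact hadd f hfJ hfI
            ((hI.notMem_closure_iff_of_notMem hfI (hJ.subset_ground hfJ)).1 hf)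
  let N : Matroid (Option α) := (IndepMatroid.ofFinite (E := insert none (some '' M.E))
    (toFinite _) Ind (by simp [Ind])
    (fun I J hJ hIJ => ⟨hJ.1.subset (preimage_mono hIJ),
      fun h hP => hJ.2 (hIJ h) (hmono (preimage_mono hIJ) hP)⟩)
    haug
    (fun I hI => by
      rintro (_ | x) hx
      · simp
      · exact Or.inr ⟨x, hI.1.subset_ground hx, rfl⟩)).matroid
  have hN : ∀ J, N.Indep J ↔ M.Indep (some ⁻¹' J) ∧ (none ∈ J → ¬ P (some ⁻¹' J)) :=
    fun J => Iff.rfl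
  have hNE : N.E = insert none (some '' M.E) := rfl
  refine ⟨N, ⟨by rw [hNE]; simp, fun hco => ?_, ?_⟩, hN⟩
  -- A coloop could be added to a base `B` of `M`, but `P M.E` forces `P B`.
  · obtain ⟨B, hB⟩ := M.exists_isBase
    have hpre : some ⁻¹' (some '' B) = B := preimage_image_eq _ (Option.some_injective α)
    have hBN : N.Indep (some '' B) := by
      rw [hN, hpre]; exact ⟨hB.indep, by simp⟩
    have := hco.insert_indep_of_indep hBN
    rw [hN, preimage_some_insert_none, hpre] at this
    refine this.2 (mem_insert _ _) (hcl _ ?_)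
    rwa [hB.closure_eq]
  · refine Matroid.ext_indep ?_ fun I hI => ?_
    · rw [Matroid.delete_ground, hNE, Matroid.map_ground]
      simp
    · have hnI : none ∉ I := fun h => (hI h).2 rfl
      rw [Matroid.deleteElem_indep_iff, hN, Matroid.map_indep_iff]
      constructor
      · rintro ⟨⟨h, -⟩, -⟩
        exact ⟨_, h, eq_image_some_of_notMem hnI⟩
      · rintro ⟨I₀, h, rfl⟩
        rw [preimage_image_eq _ (Option.some_injective α)]
        exact ⟨⟨h, fun h => (hnI h).elim⟩, hnI⟩

end ExtensionExistence

/-! ### How the new element is spanned in a given extension. -/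

section ExtensionClosure

variable {α : Type*} {M : Matroid α} {N : Matroid (Option α)}

theorem ground_eq_of_mem_extensions (hN : N ∈ extensions M) :
    N.E = insert none (some '' M.E) := by
  have h := congrArg Matroid.E hN.2.2
  rw [Matroid.delete_ground, Matroid.map_ground] at h
  rw [← h, insert_sdiff_singleton, insert_eq_of_mem hN.1]

theorem indep_image_some_iff (hN : N ∈ extensions M) (I : Set α) :
    N.Indep (some '' I) ↔ M.Indep I := by
  have h : (N.delete {none}).Indep (some '' I) ↔ (M.map some (Option.some_injective α).injOn).Indep
    (some '' I) := by rw [hN.2.2]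
  rw [Matroid.deleteElem_indep_iff, Matroid.map_indep_iff] at h
  simp only [mem_image, reduceCtorEq, and_false, exists_false, not_false_eq_true, and_true] at h
  rw [h]
  constructor
  · rintro ⟨J, hJ, hIJ⟩
    rwa [(Option.some_injective α).image_injective hIJ]
  · exact fun h => ⟨I, h, rfl⟩

theorem some_mem_closure_iff (hN : N ∈ extensions M) (X : Set α) (f : α) :
    some f ∈ N.closure (some '' X) ↔ f ∈ M.closure X := by
  have h : (N.delete {none}).closure (some '' X) =
    (M.map some (Option.some_injective α).injOn).closure (some '' X) := by rw [hN.2.2]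
  rw [Matroid.delete_closure_eq_of_disjoint _ (by simp), Matroid.map_closure_eq,
    preimage_image_eq _ (Option.some_injective α)] at h
  have h2 := Set.ext_iff.1 h (some f)
  simpa using h2

theorem none_mem_closure_ground (hN : N ∈ extensions M) : none ∈ N.closure (some '' M.E) := by
  have h := hN.2.1
  rw [Matroid.isColoop_iff_notMem_closure_compl hN.1, not_not] at h
  convert h using 2
  rw [ground_eq_of_mem_extensions hN]
  simp

/-- By exchange, `X` with `f` and `X` with `g` both have the closure of `X` with the new element. So
among the flats covering the closure of `X`, at most one spans the new element unless `X` already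
does. -/
theorem mem_closure_insert_of_mem_closure_inserts (hN : N ∈ extensions M) {X : Set α} {f g : α}
    (hX : none ∉ N.closure (some '' X)) (hf : none ∈ N.closure (some '' (insert f X)))
    (hg : none ∈ N.closure (some '' (insert g X))) : f ∈ M.closure (insert g X) := by
  rw [← some_mem_closure_iff hN]
  rw [image_insert_eq] at hf hg ⊢
  rw [← Matroid.closure_insert_congr ⟨hg, hX⟩]
  exact (Matroid.closure_exchange ⟨hf, hX⟩).1

theorem none_mem_closure_of_subset_closure (hN : N ∈ extensions M) {X Y : Set α}
    (hXY : X ⊆ M.closure Y) (hX : none ∈ N.closure (some '' X)) :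
    none ∈ N.closure (some '' Y) := by
  refine N.closure_subset_closure_of_subset_closure ?_ hX
  rintro _ ⟨x, hx, rfl⟩
  exact (some_mem_closure_iff hN _ _).2 (hXY hx)

/-- Independent sets through the new element are the independent sets of `M` not spanning it, with
it added. -/
theorem eq_of_forall_none_mem_closure_iff {N' : Matroid (Option α)} (hN : N ∈ extensions M)
    (hN' : N' ∈ extensions M)
    (h : ∀ I, I ⊆ M.E → (none ∈ N.closure (some '' I) ↔ none ∈ N'.closure (some '' I))) :
    N = N' := by
  refine Matroid.ext_indep ?_ fun J hJ => ?_
  · rw [ground_eq_of_mem_extensions hN, ground_eq_of_mem_extensions hN']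
  · by_cases hnJ : none ∈ J
    · rw [eq_insert_none_of_mem hnJ, Matroid.insert_indep_iff, Matroid.insert_indep_iff,
        indep_image_some_iff hN, indep_image_some_iff hN']
      refine and_congr_right fun hi => ?_
      rw [mem_sdiff, mem_sdiff, h _ hi.subset_ground]
      simp [hN.1, hN'.1]
    · rw [eq_image_some_of_notMem hnJ, indep_image_some_iff hN, indep_image_some_iff hN']

end ExtensionClosure

end CliqueExt

/-! ### Extensions of the clique matroid as families of cuts. -/

namespace CliqueExt

open SimpleGraph Set

section Cuts

variable {V : Type*}

/-- No edge in `X` has exactly one end in `A`. -/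
def Uncut (X : Set (Sym2 V)) (A : Set V) : Prop :=
  ∀ x y, s(x, y) ∈ X → (x ∈ A ↔ y ∈ A)

theorem Uncut.anti {X Y : Set (Sym2 V)} {A : Set V} (h : Uncut Y A) (hXY : X ⊆ Y) : Uncut X A :=
  fun x y hxy => h x y (hXY hxy)

theorem uncut_insert {X : Set (Sym2 V)} {A : Set V} {u v : V} :
    Uncut (insert s(u, v) X) A ↔ (u ∈ A ↔ v ∈ A) ∧ Uncut X A := by
  constructor
  · exact fun h => ⟨h u v (mem_insert _ _), h.anti (subset_insert _ _)⟩
  · rintro ⟨h1, h2⟩ x y (h | h)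
    · rcases Sym2.eq_iff.1 h with ⟨rfl, rfl⟩ | ⟨rfl, rfl⟩
      · exact h1
      · exact h1.symm
    · exact h2 x y h

theorem Uncut.compl {X : Set (Sym2 V)} {A : Set V} (h : Uncut X A) : Uncut X Aᶜ :=
  fun x y hxy => not_congr (h x y hxy)

theorem Uncut.inter {X : Set (Sym2 V)} {A B : Set V} (hA : Uncut X A) (hB : Uncut X B) :
    Uncut X (A ∩ B) :=
  fun x y hxy => and_congr (hA x y hxy) (hB x y hxy)

/-- The edges of the complete graph on `V` that have both ends in `A` or both ends outside of `A`.
If `A` is nonempty and proper, this is a hyperplane of the cycle matroid. -/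
def uncrossed (A : Set V) : Set (Sym2 V) :=
  {e | ¬ e.IsDiag ∧ Uncut {e} A}

theorem mk_mem_uncrossed {A : Set V} {u v : V} :
    s(u, v) ∈ uncrossed A ↔ u ≠ v ∧ (u ∈ A ↔ v ∈ A) := by
  refine and_congr (by simp) ?_
  rw [← insert_empty_eq, uncut_insert]
  exact and_iff_left fun x y h => h.elim

theorem uncut_uncrossed (A : Set V) : Uncut (uncrossed A) A :=
  fun _ _ h => (mk_mem_uncrossed.1 h).2

theorem uncrossed_compl (A : Set V) : uncrossed Aᶜ = uncrossed A := by
  ext e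
  induction e with
  | h x y => simp only [mk_mem_uncrossed, mem_compl_iff, not_iff_not]

/-- The two sides of `A` induce complete graphs, so `D` is constant on each. -/
theorem eq_or_eq_compl_of_uncut_uncrossed {A D : Set V} (h : Uncut (uncrossed A) D)
    (hA : A.Nonempty) (hD : D.Nonempty) (hD' : Dᶜ.Nonempty) : D = A ∨ D = Aᶜ := by
  have key : ∀ x y, (x ∈ A ↔ y ∈ A) → (x ∈ D ↔ y ∈ D) := by
    intro x y hxy
    by_cases hne : x = y
    · rw [hne]
    · exact h x y (mk_mem_uncrossed.2 ⟨hne, hxy⟩)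
  obtain ⟨a, ha⟩ := hA
  obtain ⟨d, hd⟩ := hD
  obtain ⟨c, hc⟩ := hD'
  rw [mem_compl_iff] at hc
  by_cases haD : a ∈ D
  · left
    ext x
    have h1 := key x a
    have h2 := key c a
    have h3 := key x c
    tauto
  · right
    ext x
    have h1 := key x a
    have h2 := key d a
    have h3 := key x d
    rw [mem_compl_iff]
    tauto

theorem complete_ground [Finite V] :
    (cycleMatroid (⊤ : SimpleGraph V)).E = (⊤ : SimpleGraph V).edgeSet := rfl

theorem mk_mem_complete_ground [Finite V] {u v : V} :
    s(u, v) ∈ (cycleMatroid (⊤ : SimpleGraph V)).E ↔ u ≠ v := by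
  rw [complete_ground, mem_edgeSet, top_adj]

theorem complete_indep_iff [Finite V] {I : Set (Sym2 V)} :
    (cycleMatroid (⊤ : SimpleGraph V)).Indep I ↔
      I ⊆ (cycleMatroid (⊤ : SimpleGraph V)).E ∧ (fromEdgeSet I).IsAcyclic := Iff.rfl

theorem uncrossed_subset_ground [Finite V] (A : Set V) :
    uncrossed A ⊆ (cycleMatroid (⊤ : SimpleGraph V)).E := by
  intro e he
  induction e with
  | h x y => exact mk_mem_complete_ground.2 (mk_mem_uncrossed.1 he).1

theorem subset_uncrossed [Finite V] {X : Set (Sym2 V)} {A : Set V}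
    (hX : X ⊆ (cycleMatroid (⊤ : SimpleGraph V)).E) (h : Uncut X A) : X ⊆ uncrossed A := by
  intro e he
  induction e with
  | h x y => exact mk_mem_uncrossed.2 ⟨mk_mem_complete_ground.1 (hX he), h x y he⟩

theorem Indep.mk_mem_closure_iff_reachable [Finite V] {I : Set (Sym2 V)} {u v : V} (huv : u ≠ v)
    (hI : (cycleMatroid (⊤ : SimpleGraph V)).Indep I) :
    s(u, v) ∈ (cycleMatroid (⊤ : SimpleGraph V)).closure I ↔ (fromEdgeSet I).Reachable u v := by
  have heq : fromEdgeSet (insert s(u, v) I) = fromEdgeSet I ⊔ edge u v := by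
    rw [edge, ← fromEdgeSet_union, union_comm, singleton_union]
  have hadj : (fromEdgeSet I).Adj u v ↔ s(u, v) ∈ I := by simp [huv]
  have hr : s(u, v) ∈ I → (fromEdgeSet I).Reachable u v := fun h => (hadj.2 h).reachable
  have hac := hI.2
  rw [hI.mem_closure_iff', complete_indep_iff, heq, isAcyclic_sup_fromEdgeSet_iff, hadj,
    insert_subset_iff, mk_mem_complete_ground]
  have := hI.subset_ground
  tauto

theorem mk_mem_closure_iff_reachable [Finite V] {X : Set (Sym2 V)} {u v : V} (huv : u ≠ v) :
    s(u, v) ∈ (cycleMatroid (⊤ : SimpleGraph V)).closure X ↔ (fromEdgeSet X).Reachable u v := by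
  obtain ⟨I, hI⟩ := (cycleMatroid (⊤ : SimpleGraph V)).exists_isBasis' X
  rw [← hI.closure_eq_closure, Indep.mk_mem_closure_iff_reachable huv hI.indep]
  refine ⟨fun h => h.mono (fromEdgeSet_mono hI.subset), ?_⟩
  rintro ⟨p⟩
  clear huv
  induction p with
  | nil => exact Reachable.refl _
  | cons h _ ih =>
    refine Reachable.trans ?_ ih
    rw [fromEdgeSet_adj] at h
    rw [← Indep.mk_mem_closure_iff_reachable h.2 hI.indep, hI.closure_eq_closure]
    exact Matroid.mem_closure_of_mem' _ h.1 (mk_mem_complete_ground.2 h.2)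

/-- The closure of `X` in the cycle matroid of a complete graph is the intersection of the
hyperplanes containing `X`. -/
theorem mk_mem_closure_iff [Finite V] {X : Set (Sym2 V)} {u v : V} :
    s(u, v) ∈ (cycleMatroid (⊤ : SimpleGraph V)).closure X ↔
      u ≠ v ∧ ∀ A, Uncut X A → (u ∈ A ↔ v ∈ A) := by
  by_cases huv : u = v
  · refine iff_of_false (fun h => ?_) (fun h => h.1 huv)
    exact mk_mem_complete_ground.1 (Matroid.mem_ground_of_mem_closure h) huv
  rw [mk_mem_closure_iff_reachable huv]
  constructor
  · rintro ⟨p⟩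
    refine ⟨huv, fun A hA => ?_⟩
    clear huv
    induction p with
    | nil => exact Iff.rfl
    | cons h _ ih => exact (hA _ _ ((fromEdgeSet_adj _).1 h).1).trans ih
  · rintro ⟨-, h⟩
    refine (h {w | (fromEdgeSet X).Reachable u w} fun x y hxy => ?_).1 (Reachable.refl u)
    have hr : (fromEdgeSet X).Reachable x y := by
      by_cases hne : x = y
      · rw [hne]
      · exact Adj.reachable ((fromEdgeSet_adj _).2 ⟨hxy, hne⟩)
    exact ⟨fun h => Reachable.trans h hr, fun h => Reachable.trans h hr.symm⟩

theorem Uncut.closure [Finite V] {X : Set (Sym2 V)} {A : Set V} (h : Uncut X A) :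
    Uncut ((cycleMatroid (⊤ : SimpleGraph V)).closure X) A :=
  fun _ _ hxy => (mk_mem_closure_iff.1 hxy).2 A h

/-- All cuts that avoid `X` belong to `F`. -/
def AllCutsIn (F : Set (Set V)) (X : Set (Sym2 V)) : Prop :=
  ∀ A : Set V, A.Nonempty → Aᶜ.Nonempty → Uncut X A → A ∈ F

/-- A family of cuts, closed under complements and disjoint unions, defines an extension of the
cycle matroid of a complete graph. -/
theorem exists_extension_of_cuts [Finite V] (F : Set (Set V)) (hcompl : ∀ A, Aᶜ ∈ F → A ∈ F)
    (hunion : ∀ A ∈ F, ∀ B ∈ F, Disjoint A B → (A ∪ B)ᶜ.Nonempty → A ∪ B ∈ F) :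
    ∃ N ∈ extensions (cycleMatroid (⊤ : SimpleGraph V)), ∀ J, N.Indep J ↔
      (cycleMatroid (⊤ : SimpleGraph V)).Indep (some ⁻¹' J) ∧
        (none ∈ J → ¬ AllCutsIn F (some ⁻¹' J)) := by
  refine exists_extension_of_modular _ (AllCutsIn F) ?_ ?_ ?_ ?_
  · exact fun I J hIJ h A hA hA' hJ => h A hA hA' (hJ.anti hIJ)
  · exact fun I h A hA hA' hI => h A hA hA' hI.closure
  · intro I f g hg hf hi hPf hPg A hA hA' hIA
    have hgi := hi.subset (subset_insert _ _)
    have hfcl := (hgi.insert_indep_iff_of_notMem hf).1 hi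
    induction f with
    | h u v =>
    induction g with
    | h x y =>
    have huv : u ≠ v := mk_mem_complete_ground.1 hfcl.1
    -- `f` is not spanned by `I` with `g`, so some cut avoids these and separates the ends of `f`;
    -- complementing if needed, its side `B` misses both ends of `g`.
    have hB : ∃ B, Uncut I B ∧ x ∉ B ∧ y ∉ B ∧ ¬ (u ∈ B ↔ v ∈ B) := by
      have h := hfcl.2
      rw [mk_mem_closure_iff] at h
      push Not at h
      obtain ⟨B, hB, hne⟩ := h huv
      rw [uncut_insert] at hB
      by_cases hx : x ∈ B
      · refine ⟨Bᶜ, hB.2.compl, ?_⟩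
        simp only [mem_compl_iff]
        tauto
      · exact ⟨B, hB.2, by tauto⟩
    obtain ⟨B, hIB, hxB, hyB, huvB⟩ := hB
    by_cases hgA : x ∈ A ↔ y ∈ A
    · exact hPg A hA hA' (uncut_insert.2 ⟨hgA, hIA⟩)
    by_cases hfA : u ∈ A ↔ v ∈ A
    · exact hPf A hA hA' (uncut_insert.2 ⟨hfA, hIA⟩)
    -- A cut crossed by both `f` and `g` is split as `A ∩ B`, which `g` does not cross, and `A \ B`,
    -- which `f` does not cross because `A` and `B` agree on `u` and `v`. If they disagree, `Aᶜ` is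
    -- used instead.
    have main : ∀ A, Uncut I A → Aᶜ.Nonempty → ¬ (x ∈ A ↔ y ∈ A) → ¬ (u ∈ A ↔ v ∈ A) →
        (u ∈ A ↔ u ∈ B) → A ∈ F := by
      intro A hIA hA' hgA hfA huA
      have hint : A ∩ B ∈ F := by
        refine hPg _ ?_ ⟨x, fun h => hxB h.2⟩
          (uncut_insert.2 ⟨by simp [hxB, hyB], hIA.inter hIB⟩)
        by_cases h : u ∈ A
        · exact ⟨u, h, huA.1 h⟩
        · exact ⟨v, by grind, by grind⟩
      have hdiff : A \ B ∈ F := by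
        refine hPf _ ?_ ?_ (uncut_insert.2 ⟨?_, hIA.inter hIB.compl⟩)
        · by_cases h : x ∈ A
          · exact ⟨x, h, hxB⟩
          · exact ⟨y, by grind, hyB⟩
        · exact hA'.mono (compl_subset_compl.2 sdiff_subset)
        · rw [mem_sdiff, mem_sdiff]
          grind
      rw [← inter_union_sdiff A B]
      refine hunion _ hint _ hdiff (disjoint_sdiff_inter.symm) ?_
      rwa [inter_union_sdiff]
    by_cases huA : u ∈ A ↔ u ∈ B
    · exact main A hIA hA' hgA hfA huA
    · refine hcompl A (main Aᶜ hIA.compl (by rwa [compl_compl]) ?_ ?_ ?_) <;>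
        grind
  · rintro A ⟨a, ha⟩ ⟨b, hb⟩ h
    have hab : a ≠ b := fun h => hb (h ▸ ha)
    exact (hb ((h a b (mk_mem_complete_ground.2 hab)).1 ha)).elim

/-- The cuts `A` for which the new element of the extension `N` is spanned by the hyperplane
`uncrossed A`. -/
def cutClass (N : Matroid (Option (Sym2 V))) : Set (Set V) :=
  {A | none ∈ N.closure (some '' uncrossed A)}

theorem compl_mem_cutClass {N : Matroid (Option (Sym2 V))} {A : Set V} :
    Aᶜ ∈ cutClass N ↔ A ∈ cutClass N := by
  simp only [cutClass, mem_ofPred_eq, uncrossed_compl]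

/-- The intersection is the flat of the partition into `A`, `B` and the rest; the edge from `b` to
`c` merges the last two parts. -/
theorem uncrossed_subset_closure_insert [Finite V] {A B : Set V} {b c : V} (hdisj : Disjoint A B)
    (hb : b ∈ B) (hcA : c ∉ A) (hcB : c ∉ B) :
    uncrossed A ⊆ (cycleMatroid (⊤ : SimpleGraph V)).closure
      (insert s(b, c) (uncrossed A ∩ uncrossed B)) := by
  intro e he
  induction e with
  | h x y =>
  rw [mk_mem_uncrossed] at he
  refine mk_mem_closure_iff.2 ⟨he.1, fun D hD => ?_⟩
  rw [uncut_insert] at hD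
  have hD' : ∀ x y, (x ∈ A ↔ y ∈ A) → (x ∈ B ↔ y ∈ B) → (x ∈ D ↔ y ∈ D) := by
    intro x y h1 h2
    by_cases hne : x = y
    · rw [hne]
    · exact hD.2 x y ⟨mk_mem_uncrossed.2 ⟨hne, h1⟩, mk_mem_uncrossed.2 ⟨hne, h2⟩⟩
  have hdA : ∀ z, z ∈ A → z ∉ B := fun z h1 h2 => disjoint_left.1 hdisj h1 h2
  by_cases hx : x ∈ A
  · exact hD' x y he.2 (iff_of_false (hdA x hx) (hdA y (he.2.1 hx)))
  · have hbc : ∀ z, z ∉ A → (z ∈ D ↔ b ∈ D) := by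
      intro z hz
      by_cases hzB : z ∈ B
      · exact hD' z b (iff_of_false hz fun h => hdA b h hb) (iff_of_true hzB hb)
      · exact (hD' z c (iff_of_false hz hcA) (iff_of_false hzB hcB)).trans hD.1.symm
    exact (hbc x hx).trans (hbc y fun h => hx (he.2.2 h)).symm

theorem union_mem_cutClass [Finite V] {N : Matroid (Option (Sym2 V))}
    (hN : N ∈ extensions (cycleMatroid (⊤ : SimpleGraph V))) {A B : Set V} (hA : A ∈ cutClass N)
    (hB : B ∈ cutClass N) (hAne : A.Nonempty) (hBne : B.Nonempty) (hdisj : Disjoint A B)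
    (hAB : (A ∪ B)ᶜ.Nonempty) : A ∪ B ∈ cutClass N := by
  obtain ⟨a, ha⟩ := hAne
  obtain ⟨b, hb⟩ := hBne
  obtain ⟨c, hc⟩ := hAB
  rw [mem_compl_iff, mem_union, not_or] at hc
  have hbA : b ∉ A := fun h => disjoint_left.1 hdisj h hb
  set I := uncrossed A ∩ uncrossed B with hI
  have hsubA := uncrossed_subset_closure_insert hdisj hb hc.1 hc.2
  have hsubB := uncrossed_subset_closure_insert hdisj.symm ha hc.2 hc.1
  rw [inter_comm, ← hI] at hsubB
  rw [← hI] at hsubA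
  have hnone : none ∈ N.closure (some '' I) := by
    -- Otherwise exchange would put the edge from `a` to `c` in the closure of `I` with the edge
    -- from `b` to `c`, all of whose edges avoid the cut `A`.
    by_contra hcon
    have h := mem_closure_insert_of_mem_closure_inserts hN hcon
      (none_mem_closure_of_subset_closure hN hsubB hB)
      (none_mem_closure_of_subset_closure hN hsubA hA)
    have h2 := (mk_mem_closure_iff.1 h).2 A
      (uncut_insert.2 ⟨iff_of_false hbA hc.1, (uncut_uncrossed A).anti inter_subset_left⟩)
    exact hc.1 (h2.1 ha)
  refine N.closure_subset_closure (image_mono ?_) hnone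
  intro e he
  induction e with
  | h x y =>
  obtain ⟨h1, h2⟩ := he
  rw [mk_mem_uncrossed] at h1 h2
  exact mk_mem_uncrossed.2 ⟨h1.1, or_congr h1.2 h2.2⟩

/-- A maximal superset `Y` of `X` not spanning the new element contains a hyperplane. That
hyperplane comes from a cut avoiding `X`, so it spans the new element, a contradiction. This is why
the hyperplanes determine the extension. -/
theorem none_mem_closure_iff [Finite V] {N : Matroid (Option (Sym2 V))}
    (hN : N ∈ extensions (cycleMatroid (⊤ : SimpleGraph V))) {X : Set (Sym2 V)}
    (hX : X ⊆ (cycleMatroid (⊤ : SimpleGraph V)).E) :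
    none ∈ N.closure (some '' X) ↔ AllCutsIn (cutClass N) X := by
  refine ⟨fun h A _ _ hXA => N.closure_subset_closure (image_mono (subset_uncrossed hX hXA)) h,
    fun h => ?_⟩
  by_contra hcon
  obtain ⟨Y, hXY, hY⟩ := Finite.exists_le_maximal
    (p := fun Y => Y ⊆ (cycleMatroid (⊤ : SimpleGraph V)).E ∧ none ∉ N.closure (some '' Y))
    ⟨hX, hcon⟩
  have hins : ∀ f ∈ (cycleMatroid (⊤ : SimpleGraph V)).E, f ∉ Y →
      none ∈ N.closure (some '' (insert f Y)) := by
    intro f hf hfY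
    by_contra hf'
    exact hfY (hY.2 ⟨insert_subset hf hY.1.1, hf'⟩ (subset_insert _ _) (mem_insert _ _))
  obtain ⟨f, hfE, hfY⟩ : ∃ f ∈ (cycleMatroid (⊤ : SimpleGraph V)).E, f ∉ Y := by
    by_contra! hall
    exact hY.1.2 (N.closure_subset_closure (image_mono hall) (none_mem_closure_ground hN))
  have hfcl : f ∉ (cycleMatroid (⊤ : SimpleGraph V)).closure Y := by
    intro hf
    refine hY.1.2 (none_mem_closure_of_subset_closure hN ?_ (hins f hfE hfY))
    exact insert_subset hf (Matroid.subset_closure _ _ hY.1.1)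
  induction f with
  | h u v =>
  rw [mk_mem_closure_iff] at hfcl
  push Not at hfcl
  obtain ⟨A, hYA, hA⟩ := hfcl (mk_mem_complete_ground.1 hfE)
  have hsub : uncrossed A ⊆ Y := by
    intro g hg
    by_contra hgY
    have h := mem_closure_insert_of_mem_closure_inserts hN hY.1.2 (hins _ hfE hfY)
      (hins g (uncrossed_subset_ground A hg) hgY)
    induction g with
    | h x y =>
    have := (mk_mem_closure_iff.1 h).2 A (uncut_insert.2 ⟨(mk_mem_uncrossed.1 hg).2, hYA⟩)
    tauto
  refine hY.1.2 (N.closure_subset_closure (image_mono hsub) (h A ?_ ?_ (hYA.anti hXY)))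
  · by_cases hu : u ∈ A
    · exact ⟨u, hu⟩
    · exact ⟨v, by tauto⟩
  · by_cases hu : u ∈ A
    · exact ⟨v, show v ∉ A by tauto⟩
    · exact ⟨u, hu⟩

end Cuts

end CliqueExt

/-! ### Counting the cut families. -/

namespace CliqueExt

open SimpleGraph Set

section Counting

/-- A family of finite sets that is closed under proper differences is contained in every family
that is closed under disjoint unions and contains its minimal members. -/
theorem subset_of_minimal_mem {X : Type*} [DecidableEq X] {G G' : Set (Finset X)}
    (hG : ∀ s ∈ G, ∀ t ∈ G, s ⊂ t → t \ s ∈ G)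
    (hG' : ∀ s ∈ G', ∀ t ∈ G', Disjoint s t → s ∪ t ∈ G') (hne : ∀ s ∈ G, s.Nonempty)
    (hmin : ∀ s, Minimal (· ∈ G) s → s ∈ G') : G ⊆ G' := by
  intro t
  induction t using Finset.strongInduction with
  | H t ih =>
  intro ht
  obtain ⟨s, hst, hs⟩ := exists_minimal_le_of_wellFoundedLT (· ∈ G) t ht
  rcases eq_or_ne s t with rfl | hne'
  · exact hmin _ hs
  have hss : s ⊂ t := lt_of_le_of_ne hst hne'
  have h := hG' _ (hmin _ hs) _ (ih (t \ s) (Finset.sdiff_ssubset hst (hne _ hs.1))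
    (hG _ hs.1 _ ht hss)) Finset.disjoint_sdiff
  rwa [Finset.union_sdiff_of_subset hst] at h

/-- Ensures that `ncard` of the extensions is a genuine count and not the default 0 of an infinite
set. -/
instance finite_matroid {α : Type*} [Finite α] : Finite (Matroid α) :=
  Finite.of_injective (fun M : Matroid α => (M.E, {I | M.Indep I})) fun M M' h => by
    rw [Prod.mk.injEq] at h
    exact Matroid.ext_indep h.1 fun I _ => Set.ext_iff.1 h.2 I

variable {n : ℕ}

/-- Subsets of `Fin n`, viewed as the subsets of `Fin (n + 1)` not containing `0`. -/
def succImage (s : Finset (Fin n)) : Set (Fin (n + 1)) := Fin.succ '' (s : Set (Fin n))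

theorem zero_notMem_succImage (s : Finset (Fin n)) : 0 ∉ succImage s := by
  rintro ⟨x, -, hx⟩
  exact Fin.succ_ne_zero x hx

theorem succImage_injective : Function.Injective (succImage : Finset (Fin n) → _) :=
  fun _ _ h => Finset.coe_injective ((Fin.succ_injective n).image_injective h)

theorem succImage_compl_nonempty (s : Finset (Fin n)) : (succImage s)ᶜ.Nonempty :=
  ⟨0, zero_notMem_succImage s⟩

theorem exists_eq_succImage {A : Set (Fin (n + 1))} (h : 0 ∉ A) : ∃ s, A = succImage s := by
  refine ⟨(Set.toFinite (Fin.succ ⁻¹' A)).toFinset, ?_⟩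
  rw [succImage, Finite.coe_toFinset, image_preimage_eq_inter_range, Fin.range_succ]
  ext x
  simp only [mem_inter_iff, mem_compl_iff, mem_singleton_iff]
  exact ⟨fun hx => ⟨hx, fun h0 => h (h0 ▸ hx)⟩, fun hx => hx.1⟩

theorem succImage_union (s t : Finset (Fin n)) :
    succImage (s ∪ t) = succImage s ∪ succImage t := by
  simp [succImage, image_union]

theorem succImage_nonempty {s : Finset (Fin n)} : (succImage s).Nonempty ↔ s.Nonempty := by
  simp [succImage]

theorem disjoint_succImage {s t : Finset (Fin n)} :
    Disjoint (succImage s) (succImage t) ↔ Disjoint s t := by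
  rw [succImage, succImage, disjoint_image_iff (Fin.succ_injective n), Finset.disjoint_coe]

/-- The cuts spanning the new element of an extension, represented by the side avoiding `0`. -/
def cutFamily (N : Matroid (Option (Sym2 (Fin (n + 1))))) : Set (Finset (Fin n)) :=
  {s | s.Nonempty ∧ succImage s ∈ cutClass N}

theorem union_mem_cutFamily {N : Matroid (Option (Sym2 (Fin (n + 1))))}
    (hN : N ∈ extensions (cycleMatroid (⊤ : SimpleGraph (Fin (n + 1))))) {s t : Finset (Fin n)}
    (hs : s ∈ cutFamily N) (ht : t ∈ cutFamily N) (hst : Disjoint s t) : s ∪ t ∈ cutFamily N := by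
  refine ⟨hs.1.mono Finset.subset_union_left, ?_⟩
  rw [succImage_union]
  refine union_mem_cutClass hN hs.2 ht.2 (succImage_nonempty.2 hs.1) (succImage_nonempty.2 ht.1)
    (disjoint_succImage.2 hst) ?_
  rw [← succImage_union]
  exact succImage_compl_nonempty _

/-- `t \ s` is the complement of the disjoint union of `s` with the side of `t` containing 0. -/
theorem sdiff_mem_cutFamily {N : Matroid (Option (Sym2 (Fin (n + 1))))}
    (hN : N ∈ extensions (cycleMatroid (⊤ : SimpleGraph (Fin (n + 1))))) {s t : Finset (Fin n)}
    (hs : s ∈ cutFamily N) (ht : t ∈ cutFamily N) (hst : s ⊂ t) : t \ s ∈ cutFamily N := by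
  have hne : (t \ s).Nonempty := Finset.sdiff_nonempty.2 hst.2
  refine ⟨hne, ?_⟩
  have ht' : succImage t = succImage s ∪ succImage (t \ s) := by
    rw [← succImage_union, Finset.union_sdiff_of_subset hst.1]
  have hdisj : Disjoint (succImage s) (succImage (t \ s)) :=
    disjoint_succImage.2 Finset.disjoint_sdiff
  have heq : (succImage s ∪ (succImage t)ᶜ)ᶜ = succImage (t \ s) := by
    ext x
    have : x ∈ succImage s → x ∉ succImage (t \ s) := fun h => disjoint_left.1 hdisj h
    rw [ht', mem_compl_iff, mem_union, mem_compl_iff, mem_union]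
    tauto
  rw [← heq, compl_mem_cutClass]
  refine union_mem_cutClass hN hs.2 (compl_mem_cutClass.2 ht.2) (succImage_nonempty.2 hs.1)
    (succImage_compl_nonempty t) ?_ ?_
  · rw [disjoint_compl_right_iff_subset, ht']
    exact subset_union_left
  · rw [heq]
    exact succImage_nonempty.2 hne

theorem eq_of_cutFamily_eq {N N' : Matroid (Option (Sym2 (Fin (n + 1))))}
    (hN : N ∈ extensions (cycleMatroid (⊤ : SimpleGraph (Fin (n + 1)))))
    (hN' : N' ∈ extensions (cycleMatroid (⊤ : SimpleGraph (Fin (n + 1)))))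
    (h : cutFamily N = cutFamily N') : N = N' := by
  have hzero : ∀ A : Set (Fin (n + 1)), A.Nonempty → 0 ∉ A →
      (A ∈ cutClass N ↔ A ∈ cutClass N') := by
    intro A hA hA0
    obtain ⟨s, rfl⟩ := exists_eq_succImage hA0
    have hs := Set.ext_iff.1 h s
    simp only [cutFamily, mem_ofPred_eq, succImage_nonempty.1 hA, true_and] at hs
    exact hs
  have hall : ∀ A : Set (Fin (n + 1)), A.Nonempty → Aᶜ.Nonempty →
      (A ∈ cutClass N ↔ A ∈ cutClass N') := by
    intro A hA hA'
    by_cases h0 : 0 ∈ A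
    · rw [← compl_mem_cutClass, ← compl_mem_cutClass (N := N')]
      exact hzero _ hA' fun h => h h0
    · exact hzero _ hA h0
  refine eq_of_forall_none_mem_closure_iff hN hN' fun I hI => ?_
  rw [none_mem_closure_iff hN hI, none_mem_closure_iff hN' hI]
  exact forall_congr' fun A => forall_congr' fun hA => forall_congr' fun hA' =>
    forall_congr' fun _ => hall A hA hA'

/-- Extensions of the cycle matroid of a clique are determined by an antichain of cuts. -/
theorem ncard_extensions_le_card_antichains (n : ℕ) :
    (extensions (cycleMatroid (⊤ : SimpleGraph (Fin (n + 1))))).ncard ≤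
      Finset.card {I : Finset (Finset (Fin n)) | ∀ a ∈ I, ∀ b ∈ I, ¬ (a ⊂ b ∨ b ⊂ a)} := by
  classical
  rw [← ncard_coe_finset]
  refine ncard_le_ncard_of_injOn
    (fun N => (Set.toFinite {s | Minimal (· ∈ cutFamily N) s}).toFinset) ?_ ?_
  · intro N _
    rw [Finset.mem_coe, Finset.mem_filter]
    refine ⟨Finset.mem_univ _, fun a ha b hb => ?_⟩
    rw [Finite.mem_toFinset, mem_ofPred_eq] at ha hb
    rintro (h | h)
    · exact h.2 (hb.2 ha.1 h.1)
    · exact h.2 (ha.2 hb.1 h.1)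
  · intro N hN N' hN' h
    have hmin : ∀ s, Minimal (· ∈ cutFamily N) s ↔ Minimal (· ∈ cutFamily N') s := by
      intro s
      have := Finset.ext_iff.1 h s
      simpa only [Finite.mem_toFinset, mem_ofPred_eq] using this
    refine eq_of_cutFamily_eq hN hN' (Subset.antisymm ?_ ?_)
    · exact subset_of_minimal_mem (fun s hs t ht => sdiff_mem_cutFamily hN hs ht)
        (fun s hs t ht => union_mem_cutFamily hN' hs ht) (fun s hs => hs.1)
        (fun s hs => ((hmin s).1 hs).1)
    · exact subset_of_minimal_mem (fun s hs t ht => sdiff_mem_cutFamily hN' hs ht)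
        (fun s hs t ht => union_mem_cutFamily hN hs ht) (fun s hs => hs.1)
        (fun s hs => ((hmin s).2 hs).1)

/-- The cuts with a side in `S`. -/
def cutsOf (S : Finset (Finset (Fin n))) : Set (Set (Fin (n + 1))) :=
  {A | ∃ s ∈ S, A = succImage s ∨ Aᶜ = succImage s}

/-- The union condition is vacuous: two `k`-sets meet; a `k`-set disjoint from the complement of
another equals it, so the union is everything; two sides containing 0 meet. -/
theorem exists_extension_of_layer {k : ℕ} (hk : n < 2 * k) {S : Finset (Finset (Fin n))}
    (hS : S ⊆ Finset.powersetCard k Finset.univ) :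
    ∃ N ∈ extensions (cycleMatroid (⊤ : SimpleGraph (Fin (n + 1)))), ∀ J, N.Indep J ↔
      (cycleMatroid (⊤ : SimpleGraph (Fin (n + 1)))).Indep (some ⁻¹' J) ∧
        (none ∈ J → ¬ AllCutsIn (cutsOf S) (some ⁻¹' J)) := by
  have hcard : ∀ s ∈ S, s.card = k := fun s hs => (Finset.mem_powersetCard.1 (hS hs)).2
  have hnested : ∀ s ∈ S, ∀ t ∈ S, succImage s ⊆ succImage t → s = t := by
    intro s hs t ht h
    have : s ⊆ t := Finset.coe_subset.1 ((image_subset_image_iff (Fin.succ_injective n)).1 h)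
    exact Finset.eq_of_subset_of_card_le this (by rw [hcard s hs, hcard t ht])
  refine exists_extension_of_cuts _ ?_ ?_
  · rintro A ⟨s, hs, h | h⟩
    · exact ⟨s, hs, Or.inr h⟩
    · exact ⟨s, hs, Or.inl (by rwa [compl_compl] at h)⟩
  · rintro A ⟨s, hs, hA⟩ B ⟨t, ht, hB⟩ hdisj hAB
    exfalso
    rcases hA with rfl | hA <;> rcases hB with rfl | hB
    · rw [disjoint_succImage] at hdisj
      have h := Finset.card_le_univ (s ∪ t)
      rw [Finset.card_union_of_disjoint hdisj, hcard s hs, hcard t ht, Fintype.card_fin] at h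
      omega
    · have := hnested s hs t ht (hB ▸ hdisj.subset_compl_right)
      rw [this, ← hB, compl_union_self, compl_univ] at hAB
      exact not_nonempty_empty hAB
    · have := hnested t ht s hs (hA ▸ hdisj.subset_compl_left)
      rw [this, ← hA, union_compl_self, compl_univ] at hAB
      exact not_nonempty_empty hAB
    · have h0A : 0 ∈ A := by
        by_contra h
        exact zero_notMem_succImage s (hA ▸ h)
      have h0B : 0 ∈ B := by
        by_contra h
        exact zero_notMem_succImage t (hB ▸ h)
      exact disjoint_left.1 hdisj h0A h0B

/-- `S` can be read off its extension: a base of the hyperplane of a `k`-set avoids only that one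
cut, so it spans the new element exactly when the `k`-set is in `S`. -/
theorem two_pow_choose_le_ncard_extensions {k : ℕ} (hk : n < 2 * k) :
    2 ^ n.choose k ≤ (extensions (cycleMatroid (⊤ : SimpleGraph (Fin (n + 1))))).ncard := by
  classical
  let L : Finset (Finset (Fin n)) := Finset.powersetCard k Finset.univ
  have hex : ∀ S : Finset (Finset (Fin n)), ∃ N : Matroid (Option (Sym2 (Fin (n + 1)))), S ⊆ L →
      (N ∈ extensions (cycleMatroid (⊤ : SimpleGraph (Fin (n + 1)))) ∧ ∀ J, N.Indep J ↔
        (cycleMatroid (⊤ : SimpleGraph (Fin (n + 1)))).Indep (some ⁻¹' J) ∧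
          (none ∈ J → ¬ AllCutsIn (cutsOf S) (some ⁻¹' J))) := by
    intro S
    by_cases hS : S ⊆ L
    · obtain ⟨N, h⟩ := exists_extension_of_layer hk hS
      exact ⟨N, fun _ => h⟩
    · exact ⟨Matroid.emptyOn _, fun h => (hS h).elim⟩
  choose N hN using hex
  have hsub : ∀ S T, S ⊆ L → T ⊆ L → N S = N T → S ⊆ T := by
    intro S T hS hT h s hs
    have hsne : s.Nonempty := by
      rw [← Finset.card_pos, (Finset.mem_powersetCard.1 (hS hs)).2]
      omega
    obtain ⟨I, hI⟩ := (cycleMatroid (⊤ : SimpleGraph (Fin (n + 1)))).exists_isBasis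
      (uncrossed (succImage s)) (uncrossed_subset_ground _)
    have hpre : some ⁻¹' (insert none (some '' I)) = I := by
      rw [preimage_some_insert_none, preimage_image_eq _ (Option.some_injective _)]
    have hST : AllCutsIn (cutsOf S) I ↔ AllCutsIn (cutsOf T) I := by
      have h1 := (hN S hS).2 (insert none (some '' I))
      rw [h, (hN T hT).2, hpre] at h1
      have := hI.indep
      simp only [this, mem_insert_iff, true_or, true_and, forall_const] at h1
      exact (not_iff_not.1 h1).symm
    have hSI : AllCutsIn (cutsOf S) I := by
      intro D hD hD' hID
      refine ⟨s, hs, ?_⟩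
      have hunc : Uncut (uncrossed (succImage s)) D := hID.closure.anti hI.subset_closure
      rcases eq_or_eq_compl_of_uncut_uncrossed hunc (succImage_nonempty.2 hsne) hD hD' with h | h
      · exact Or.inl h
      · exact Or.inr (by rw [h, compl_compl])
    obtain ⟨t, ht, h | h⟩ := hST.1 hSI (succImage s) (succImage_nonempty.2 hsne)
      (succImage_compl_nonempty s) ((uncut_uncrossed _).anti hI.subset)
    · rwa [succImage_injective h]
    · exact (zero_notMem_succImage t (h ▸ zero_notMem_succImage s)).elim
  have hcard : ((L.powerset : Finset _) : Set (Finset (Finset (Fin n)))).ncard = 2 ^ n.choose k := by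
    rw [ncard_coe_finset, Finset.card_powerset, Finset.card_powersetCard, Finset.card_univ,
      Fintype.card_fin]
  rw [← hcard]
  refine ncard_le_ncard_of_injOn N (fun S hS => (hN S (Finset.mem_powerset.1 hS)).1) ?_
  intro S hS T hT h
  have hS' := Finset.mem_powerset.1 hS
  have hT' := Finset.mem_powerset.1 hT
  exact Finset.Subset.antisymm (hsub S T hS' hT' h) (hsub T S hT' hS' h.symm)

end Counting

end CliqueExt

/-! ### Asymptotic estimates. -/

namespace CliqueExt

section Asymptotics

/-- Equality holds at `m = 1`, and the ratio of the sides grows by (2m+1)²/(4m(m+1)) ≥ 1 at each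
step. -/
theorem sixteen_pow_le_centralBinom_sq (m : ℕ) (hm : 1 ≤ m) :
    16 ^ m ≤ m.centralBinom ^ 2 * (4 * m) := by
  induction m, hm using Nat.le_induction with
  | base => simp [Nat.centralBinom, Nat.choose]
  | succ m hm ih =>
    have h := Nat.succ_mul_centralBinom_succ m
    have hpos : 0 < m * (m + 1) := by positivity
    refine Nat.le_of_mul_le_mul_left ?_ hpos
    calc m * (m + 1) * 16 ^ (m + 1) = 16 * m * (m + 1) * 16 ^ m := by ring
      _ ≤ 16 * m * (m + 1) * (m.centralBinom ^ 2 * (4 * m)) := Nat.mul_le_mul_left _ ih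
      _ ≤ 4 * m * (2 * (2 * m + 1) * m.centralBinom) ^ 2 := by
        have : 4 * m * (m + 1) ≤ (2 * m + 1) ^ 2 := by nlinarith
        calc 16 * m * (m + 1) * (m.centralBinom ^ 2 * (4 * m))
            = 16 * m * m.centralBinom ^ 2 * (4 * m * (m + 1)) := by ring
          _ ≤ 16 * m * m.centralBinom ^ 2 * (2 * m + 1) ^ 2 := Nat.mul_le_mul_left _ this
          _ = _ := by ring
      _ = 4 * m * ((m + 1) * (m + 1).centralBinom) ^ 2 := by rw [h]
      _ = m * (m + 1) * ((m + 1).centralBinom ^ 2 * (4 * (m + 1))) := by ring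

theorem four_pow_le_choose_middle_sq (n : ℕ) : 4 ^ n ≤ n.choose (n / 2) ^ 2 * (2 * (n + 1)) := by
  rcases Nat.even_or_odd' n with ⟨m, rfl | rfl⟩
  · rcases Nat.eq_zero_or_pos m with rfl | hm
    · simp
    · have h := sixteen_pow_le_centralBinom_sq m hm
      rw [Nat.centralBinom_eq_two_mul_choose] at h
      rw [pow_mul, Nat.mul_div_cancel_left m two_pos]
      refine h.trans (Nat.mul_le_mul_left _ (by omega))
  · have h := sixteen_pow_le_centralBinom_sq (m + 1) (by omega)
    have hc : (m + 1).centralBinom = 2 * (2 * m + 1).choose m := by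
      rw [Nat.centralBinom_eq_two_mul_choose, show 2 * (m + 1) = 2 * m + 1 + 1 by ring,
        Nat.choose_succ_succ, Nat.choose_symm_half]
      ring
    rw [hc] at h
    rw [show (2 * m + 1) / 2 = m by omega]
    have h4 : 16 ^ (m + 1) = 4 * 4 ^ (2 * m + 1) := by
      rw [show (16 : ℕ) = 4 ^ 2 by norm_num, ← pow_mul]; ring
    rw [h4] at h
    nlinarith

theorem two_pow_le_choose_middle_mul_sqrt (n : ℕ) :
    (2 : ℝ) ^ n ≤ n.choose (n / 2) * √(2 * (n + 1)) := by
  have h : ((4 : ℝ) ^ n) ≤ (n.choose (n / 2) : ℝ) ^ 2 * (2 * (n + 1)) := by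
    exact_mod_cast four_pow_le_choose_middle_sq n
  refine (pow_le_pow_iff_left₀ (by positivity) (by positivity) two_ne_zero).1 ?_
  rw [mul_pow, Real.sq_sqrt (by positivity), ← pow_mul, mul_comm n, pow_mul]
  norm_num
  exact h

/-- The cost of moving to the layer n/2 + 1: equality for even `n`, while for odd `n` the two
coefficients coincide. -/
theorem choose_middle_succ_lower (n : ℕ) :
    (n.choose (n / 2) : ℝ) * (1 - 2 / (n + 2)) ≤ n.choose (n / 2 + 1) := by
  have h := Nat.choose_succ_right_eq n (n / 2)
  have h' : (n.choose (n / 2 + 1) : ℝ) * ((n / 2 : ℕ) + 1) =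
      n.choose (n / 2) * ((n : ℝ) - (n / 2 : ℕ)) := by
    rw [← Nat.cast_sub (Nat.div_le_self n 2)]
    exact_mod_cast h
  have hk : ((n / 2 : ℕ) : ℝ) ≤ n / 2 := Nat.cast_div_le
  have hk0 : (0 : ℝ) ≤ ((n / 2 : ℕ) : ℝ) := Nat.cast_nonneg _
  have hN : (0 : ℝ) ≤ (n.choose (n / 2) : ℝ) := Nat.cast_nonneg _
  have h1 : (1 : ℝ) - 2 / (n + 2) ≤ ((n : ℝ) - (n / 2 : ℕ)) / ((n / 2 : ℕ) + 1) := by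
    have hn2 : (0 : ℝ) < n + 2 := by positivity
    rw [one_sub_div hn2.ne', div_le_div_iff₀ hn2 (by positivity)]
    nlinarith
  calc _ ≤ (n.choose (n / 2) : ℝ) * (((n : ℝ) - (n / 2 : ℕ)) / ((n / 2 : ℕ) + 1)) :=
        mul_le_mul_of_nonneg_left h1 hN
    _ = n.choose (n / 2 + 1) := by
        rw [← mul_div_assoc, ← h', mul_div_assoc, div_self (by positivity), mul_one]

/-- The antichain bound with the parameters of the container argument expressed by `s`. -/
theorem logb_ncard_extensions_le {n s : ℕ} (hs : 1 ≤ s)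
    (hd : (3 * s ^ 4 : ℝ) < (n : ℝ) / 2 - 1) :
    Real.logb 2 (extensions (cycleMatroid (⊤ : SimpleGraph (Fin (n + 1))))).ncard ≤
      n.choose (n / 2) / (1 - 3 * s ^ 4 / ((n : ℝ) / 2 - 1)) + 3 + 2 * (1 / s ^ 3) * 2 ^ n := by
  have hs0 : (0 : ℝ) < s := by exact_mod_cast hs
  set β : ℝ := 1 / s ^ 3 with hβ
  have hβ0 : 0 < β := by positivity
  -- Bernoulli gives `(1 + β) ^ (s ^ 4)` ≥ 1 + s; its cube cancels `β = 1 / s ^ 3`.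
  have hβd : 1 ≤ β * (1 + β) ^ (3 * s ^ 4) := by
    have h1 : (s : ℝ) ≤ (1 + β) ^ (s ^ 4) := by
      have h := one_add_mul_le_pow (a := β) (by linarith) (s ^ 4)
      have h2 : ((s ^ 4 : ℕ) : ℝ) * β = s := by
        rw [hβ]; push_cast; field_simp
      linarith
    calc 1 = β * (s : ℝ) ^ 3 := by rw [hβ]; field_simp
      _ ≤ β * ((1 + β) ^ (s ^ 4)) ^ 3 := by gcongr
      _ = β * (1 + β) ^ (3 * s ^ 4) := by rw [← pow_mul, mul_comm 3]
  have hh0 : (0 : ℝ) < (n : ℝ) / 2 - 1 := lt_trans (by positivity) hd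
  have h1d : 0 < 1 - 3 * s ^ 4 / ((n : ℝ) / 2 - 1) := by
    rw [sub_pos, div_lt_one hh0]; exact hd
  set m := ⌈(n.choose (n / 2) : ℝ) / (1 - 3 * s ^ 4 / ((n : ℝ) / 2 - 1))⌉₊ with hm
  have hbound := card_antichains_le (X := Fin n) (d := 3 * s ^ 4) (m := m) hβ0.le hβd
    (by rw [Fintype.card_fin]; push_cast; exact hd)
    (by
      rw [Fintype.card_fin]
      push_cast
      rw [← div_le_iff₀ h1d]
      exact Nat.le_ceil _)
  rw [Fintype.card_fin] at hbound
  have hm_le : (m : ℝ) ≤ n.choose (n / 2) / (1 - 3 * s ^ 4 / ((n : ℝ) / 2 - 1)) + 1 :=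
    (Nat.ceil_lt_add_one (by positivity)).le
  have hle : ((extensions (cycleMatroid (⊤ : SimpleGraph (Fin (n + 1))))).ncard : ℝ) ≤
      2 ^ (m + 2) * (1 + β) ^ 2 ^ n :=
    le_trans (by exact_mod_cast ncard_extensions_le_card_antichains n) hbound
  have hpos : (0 : ℝ) < (extensions (cycleMatroid (⊤ : SimpleGraph (Fin (n + 1))))).ncard := by
    exact_mod_cast lt_of_lt_of_le (by positivity)
      (two_pow_choose_le_ncard_extensions (n := n) (k := n / 2 + 1) (by omega))
  have hlog : Real.logb 2 (1 + β) ≤ 2 * β := by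
    rw [Real.logb, div_le_iff₀ (Real.log_pos one_lt_two)]
    have h1 := Real.log_le_sub_one_of_pos (x := 1 + β) (by positivity)
    have h2 := Real.log_two_gt_d9
    nlinarith
  -- The constant 3 is 2 from `m + 2` plus 1 from the ceiling in `m`.
  calc _ ≤ Real.logb 2 (2 ^ (m + 2) * (1 + β) ^ 2 ^ n) :=
        Real.logb_le_logb_of_le one_lt_two hpos hle
    _ = (m + 2) + 2 ^ n * Real.logb 2 (1 + β) := by
        rw [Real.logb_mul (by positivity) (by positivity), Real.logb_pow, Real.logb_pow,
          Real.logb_self_eq_one one_lt_two]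
        push_cast
        ring
    _ ≤ (m + 2) + 2 ^ n * (2 * β) := by gcongr
    _ ≤ _ := by linarith

/-- Both s⁴/n and √n/s³ must vanish, so s must lie between n^(1/6) and n^(1/4) in order; s =
⌈n^(1/5)⌉ leaves errors n^(-1/5) and n^(-1/10). The 192 is 3·2⁴·4, from s ≤ 2n^(1/5) and n/2 - 1 ≥
n/4. -/
theorem logb_ncard_extensions_div_le {n : ℕ} (hn : 4 ≤ n)
    (hn' : 192 * (n : ℝ) ^ (-(1 / 5) : ℝ) < 1) :
    Real.logb 2 (extensions (cycleMatroid (⊤ : SimpleGraph (Fin (n + 1))))).ncard /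
        n.choose (n / 2) ≤
      1 / (1 - 192 * (n : ℝ) ^ (-(1 / 5) : ℝ)) + 3 / n + 4 * (n : ℝ) ^ (-(1 / 10) : ℝ) := by
  have hn4 : (4 : ℝ) ≤ n := by exact_mod_cast hn
  have hn0 : (0 : ℝ) < n := by linarith
  set y : ℝ := (n : ℝ) ^ (1 / 5 : ℝ) with hy
  have hy1 : 1 ≤ y := Real.one_le_rpow (by linarith) (by norm_num)
  have hy5 : y ^ 5 = n := by
    rw [hy, ← Real.rpow_natCast, ← Real.rpow_mul hn0.le]; norm_num
  have hyinv : (n : ℝ) ^ (-(1 / 5) : ℝ) = 1 / y := by rw [Real.rpow_neg hn0.le, one_div y]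
  set s := ⌈y⌉₊ with hs
  have hys : y ≤ s := Nat.le_ceil y
  have hs2 : (s : ℝ) ≤ 2 * y := by
    have := Nat.ceil_lt_add_one (a := y) (by linarith)
    linarith
  have hs1 : 1 ≤ s := by
    have : (1 : ℝ) ≤ s := hy1.trans hys
    exact_mod_cast this
  have hh : (n : ℝ) / 4 ≤ (n : ℝ) / 2 - 1 := by linarith
  have hh0 : (0 : ℝ) < (n : ℝ) / 2 - 1 := by linarith
  have hdh : 3 * (s : ℝ) ^ 4 / ((n : ℝ) / 2 - 1) ≤ 192 * (1 / y) := by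
    have h1 : (s : ℝ) ^ 4 ≤ (2 * y) ^ 4 := by gcongr
    rw [div_le_iff₀ hh0]
    calc 3 * (s : ℝ) ^ 4 ≤ 48 * y ^ 4 := by nlinarith
      _ = 192 * (1 / y) * (n / 4) := by rw [← hy5]; field_simp; norm_num
      _ ≤ _ := by gcongr
  rw [hyinv] at hn' ⊢
  have hd : (3 * (s : ℝ) ^ 4) < (n : ℝ) / 2 - 1 := by
    rw [← div_lt_one hh0]; linarith
  have hkey := logb_ncard_extensions_le hs1 hd
  set N : ℝ := (n.choose (n / 2) : ℝ) with hN
  have hNn : (n : ℝ) ≤ N := by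
    have := Nat.choose_le_middle 1 n
    rw [Nat.choose_one_right] at this
    rw [hN]
    exact_mod_cast this
  have hN0 : 0 < N := by linarith
  have hterm : 2 * (1 / (s : ℝ) ^ 3) * 2 ^ n ≤ 4 * (n : ℝ) ^ (-(1 / 10) : ℝ) * N := by
    have hsq : √(2 * ((n : ℝ) + 1)) ≤ 2 * (n : ℝ) ^ (1 / 2 : ℝ) := by
      rw [← Real.sqrt_eq_rpow]
      refine Real.sqrt_le_iff.2 ⟨by positivity, ?_⟩
      rw [mul_pow, Real.sq_sqrt hn0.le]
      linarith
    have hy3 : 1 / (s : ℝ) ^ 3 ≤ (n : ℝ) ^ (-(3 / 5) : ℝ) := by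
      have : (n : ℝ) ^ (-(3 / 5) : ℝ) = 1 / y ^ 3 := by
        rw [Real.rpow_neg hn0.le, hy, ← Real.rpow_natCast, ← Real.rpow_mul hn0.le, one_div]
        norm_num
      rw [this]
      gcongr
    calc 2 * (1 / (s : ℝ) ^ 3) * 2 ^ n
        ≤ 2 * (n : ℝ) ^ (-(3 / 5) : ℝ) * (N * (2 * (n : ℝ) ^ (1 / 2 : ℝ))) := by
          gcongr
          exact (two_pow_le_choose_middle_mul_sqrt n).trans (by gcongr)
      _ = 4 * ((n : ℝ) ^ (-(3 / 5) : ℝ) * (n : ℝ) ^ (1 / 2 : ℝ)) * N := by ring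
      _ = _ := by rw [← Real.rpow_add hn0]; norm_num
  have h1d : 0 < 1 - 192 * (1 / y) := by linarith
  have hfirst : N / (1 - 3 * (s : ℝ) ^ 4 / ((n : ℝ) / 2 - 1)) ≤ 1 / (1 - 192 * (1 / y)) * N := by
    rw [one_div_mul_eq_div]
    gcongr
  have hthree : 3 ≤ 3 / (n : ℝ) * N := by
    rw [div_mul_eq_mul_div, le_div_iff₀ hn0]; linarith
  rw [div_le_iff₀ hN0]
  calc _ ≤ _ := hkey
    _ ≤ _ := by linarith

end Asymptotics

end CliqueExt

theorem theorem1 :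
    ∃ ε : ℕ → ℝ, Filter.Tendsto ε Filter.atTop (nhds 0) ∧
      ∀ n : ℕ,
        ((CliqueExt.extensions
            (CliqueExt.cycleMatroid (⊤ : SimpleGraph (Fin (n + 1))))).ncard : ℝ) =
          (2 : ℝ) ^ ((n.choose (n / 2) : ℝ) * (1 + ε n)) := by
  set c : ℕ → ℝ := fun n => ((CliqueExt.extensions
    (CliqueExt.cycleMatroid (⊤ : SimpleGraph (Fin (n + 1))))).ncard : ℝ) with hc
  have hlow : ∀ n, (2 : ℝ) ^ n.choose (n / 2 + 1) ≤ c n := fun n => by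
    simp only [hc]
    exact_mod_cast CliqueExt.two_pow_choose_le_ncard_extensions (n := n) (k := n / 2 + 1) (by omega)
  have hpos : ∀ n, 0 < c n := fun n => lt_of_lt_of_le (by positivity) (hlow n)
  have hN : ∀ n : ℕ, (0 : ℝ) < n.choose (n / 2) := fun n => by
    exact_mod_cast Nat.choose_pos (Nat.div_le_self n 2)
  -- This `ε` solves the required equation exactly, so only its limit needs the bounds.
  refine ⟨fun n => Real.logb 2 (c n) / n.choose (n / 2) - 1, ?_, fun n => ?_⟩
  · have hpow : ∀ a : ℝ, 0 < a →
        Filter.Tendsto (fun n : ℕ => (n : ℝ) ^ (-a)) Filter.atTop (nhds 0) :=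
      fun a ha => (tendsto_rpow_neg_atTop ha).comp tendsto_natCast_atTop_atTop
    have h5 := hpow (1 / 5) (by norm_num)
    have h10 := hpow (1 / 10) (by norm_num)
    have hinv : Filter.Tendsto (fun n : ℕ => 3 / (n : ℝ)) Filter.atTop (nhds 0) :=
      tendsto_const_nhds.div_atTop tendsto_natCast_atTop_atTop
    have hlower : Filter.Tendsto (fun n : ℕ => -(2 / ((n : ℝ) + 2))) Filter.atTop (nhds 0) := by
      rw [← neg_zero]
      exact (tendsto_const_nhds.div_atTop
        (Filter.tendsto_atTop_add_const_right _ _ tendsto_natCast_atTop_atTop)).neg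
    have hupper : Filter.Tendsto (fun n : ℕ => 1 / (1 - 192 * (n : ℝ) ^ (-(1 / 5) : ℝ)) + 3 / n +
        4 * (n : ℝ) ^ (-(1 / 10) : ℝ) - 1) Filter.atTop (nhds 0) := by
      have h := (((tendsto_const_nhds (x := (1 : ℝ))).div
        ((tendsto_const_nhds (x := (1 : ℝ))).sub (h5.const_mul 192)) (by norm_num)).add hinv).add
        (h10.const_mul 4) |>.sub_const 1
      norm_num at h ⊢
      exact h
    refine tendsto_of_tendsto_of_tendsto_of_le_of_le' hlower hupper
      (Filter.Eventually.of_forall fun n => ?_) ?_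
    · have h1 : (n.choose (n / 2 + 1) : ℝ) ≤ Real.logb 2 (c n) := by
        rw [Real.le_logb_iff_rpow_le one_lt_two (hpos n), Real.rpow_natCast]
        exact hlow n
      have h2 := (CliqueExt.choose_middle_succ_lower n).trans h1
      rw [mul_comm, ← le_div_iff₀ (hN n)] at h2
      linarith
    · have hsmall : ∀ᶠ n : ℕ in Filter.atTop, 192 * (n : ℝ) ^ (-(1 / 5) : ℝ) < 1 := by
        have := h5.const_mul 192
        rw [mul_zero] at this
        exact this.eventually_lt_const one_pos
      filter_upwards [hsmall, Filter.eventually_ge_atTop 4] with n hn hn4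
      exact sub_le_sub_right (CliqueExt.logb_ncard_extensions_div_le hn4 hn) 1
  · rw [add_sub_cancel, mul_div_cancel₀ _ (hN n).ne', Real.rpow_logb two_pos (by norm_num) (hpos n)]
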